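/- Let $X$ be a (real or complex) Banach space with topological dual $X'$. A norm bounded set $A\subseteq X$ is called a Dunford-Pettis set if for every weakly null sequence $(f_n)$ in $X'$ (that is, $f_n\to 0$ in the weak topology $\sigma(X',X'')$) one has $\lim_{n\to\infty}\sup_{x\in A}|f_n(x)|=0$. The space $X$ has the relatively compact Dunford-Pettis property (DPrcP) if every Dunford-Pettis set in $X$ is relatively compact in norm. A norm bounded set $A\subseteq X'$ is called an L-Dunford-Pettis set if for every weakly null sequence $(x_n)$ in $X$ such that $\{x_n : n\in\mathbb N\}$ is a Dunford-Pettis set in $X$ one has $\lim_{n\to\infty}\sup_{f\in A}|f(x_n)|=0$. **Theorem.** A Banach space $X$ has the DPrcP if and only if every norm bounded subset of $X'$ is an L-Dunford-Pettis set. -/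

import Mathlib

open Filter Topology

/-- A sequence in a normed space is weakly null: it converges to `0` in the weak topology. -/
def IsWeaklyNull (𝕜 : Type*) {E : Type*} [RCLike 𝕜] [NormedAddCommGroup E] [NormedSpace 𝕜 E]
    (x : ℕ → E) : Prop :=
  Tendsto (fun n => toWeakSpace 𝕜 E (x n)) atTop (𝓝 0)

/-- A norm bounded set `A ⊆ X` is a Dunford-Pettis set if every weakly null sequence of the dual
(weakly null for the weak topology of the Banach space `X'`, not for the weak-star topology)
converges to `0` uniformly on `A`. -/
def IsDunfordPettisSet (𝕜 : Type*) {X : Type*} [RCLike 𝕜] [NormedAddCommGroup X]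
    [NormedSpace 𝕜 X] (A : Set X) : Prop :=
  Bornology.IsBounded A ∧
    ∀ f : ℕ → StrongDual 𝕜 X, IsWeaklyNull 𝕜 f →
      TendstoUniformlyOn (fun n x => f n x) (fun _ => 0) atTop A

/-- The relatively compact Dunford-Pettis property: every Dunford-Pettis set is relatively
compact in norm. -/
def HasDPrcP (𝕜 X : Type*) [RCLike 𝕜] [NormedAddCommGroup X] [NormedSpace 𝕜 X] : Prop :=
  ∀ A : Set X, IsDunfordPettisSet 𝕜 A → IsCompact (closure A)

/-- A norm bounded set `A ⊆ X'` is an L-Dunford-Pettis set if every weakly null sequence `(xₙ)`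
of `X` whose set of terms is a Dunford-Pettis set converges to `0` uniformly on `A`. -/
def IsLDunfordPettisSet {𝕜 X : Type*} [RCLike 𝕜] [NormedAddCommGroup X] [NormedSpace 𝕜 X]
    (A : Set (StrongDual 𝕜 X)) : Prop :=
  Bornology.IsBounded A ∧
    ∀ x : ℕ → X, IsWeaklyNull 𝕜 x → IsDunfordPettisSet 𝕜 (Set.range x) →
      TendstoUniformlyOn (fun n (f : StrongDual 𝕜 X) => f (x n)) (fun _ => 0) atTop A

/-! If `X` has the DPrcP, a weakly null sequence whose range is Dunford-Pettis lies in a norm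
compact set, so it is norm null, hence null uniformly on bounded sets of functionals. Conversely, a
Dunford-Pettis set that is not totally bounded contains a `δ`-separated sequence. Along a weakly
Cauchy subsequence, consecutive differences are weakly null, have Dunford-Pettis range and norm at
least `δ`, which contradicts the hypothesis for the dual unit ball. The crux is
`IsDunfordPettisSet.exists_weakly_cauchy_subsequence`. By Rosenthal's dichotomy, failure gives `a <
b` and terms `x k` on which unit-ball functionals realise every finite pattern of real parts above
`b` or below `a`. Rademacher averages of these functionals satisfy an upper `ℓ²` estimate; their
weak-star limits `g k` are therefore weakly null, yet `re (g k (x k)) ≥ (b - a) / 2`. -/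

/-- The sequence of pairs `(L false n, L true n)` converges on `C` along `M`: no point of `C` lies,
for infinitely many `n ∈ M`, in `L false n` and, for infinitely many `n ∈ M`, in `L true n`. -/
def PairsConvergeOn {Ω : Type*} (L : Bool → ℕ → Set Ω) (M : Set ℕ) (C : Set Ω) : Prop :=
  ∀ t ∈ C, ∃ b, {n ∈ M | t ∈ L b n}.Finite

/-- No subsequence of the pairs along `M` converges on `C`. -/
def PairsNowhereConverge {Ω : Type*} (L : Bool → ℕ → Set Ω) (M : Set ℕ) (C : Set Ω) : Prop :=
  ∀ M' ⊆ M, M'.Infinite → ¬ PairsConvergeOn L M' C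

/-! ### Rosenthal's combinatorics of pairs of sets -/

section Combinatorics

variable {Ω : Type*} {L : Bool → ℕ → Set Ω} {M M' : Set ℕ} {C : Set Ω}

theorem PairsConvergeOn.of_diff_finite (h : PairsConvergeOn L M C) (hM : (M' \ M).Finite) :
    PairsConvergeOn L M' C := by
  intro t ht
  obtain ⟨b, hb⟩ := h t ht
  refine ⟨b, (hb.union hM).subset ?_⟩
  rintro n ⟨hn, hnt⟩
  by_cases hnM : n ∈ M
  · exact Or.inl ⟨hnM, hnt⟩
  · exact Or.inr ⟨hn, hnM⟩

theorem PairsNowhereConverge.nonempty (h : PairsNowhereConverge L M C) (hM : M.Infinite) :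
    C.Nonempty := by
  by_contra hC
  rw [Set.not_nonempty_iff_eq_empty] at hC
  subst hC
  exact h M subset_rfl hM (fun t ht => ht.elim)

/-- Diagonalization: countably many properties of infinite sets that are stable under almost
inclusion and that hold densely hold simultaneously. -/
theorem exists_infinite_subset_forall {P : ℕ → Set ℕ → Prop}
    (hP : ∀ i M M', P i M → (M' \ M).Finite → P i M') (hM : M.Infinite)
    (hdense : ∀ i, ∀ N ⊆ M, N.Infinite → ∃ N' ⊆ N, N'.Infinite ∧ P i N') :
    ∃ N ⊆ M, N.Infinite ∧ ∀ i, P i N := by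
  choose! g hgsub hginf hgP using hdense
  let S : ℕ → Set ℕ := fun k => Nat.rec M (fun i N => g i N) k
  have hS : ∀ k, S k ⊆ M ∧ (S k).Infinite := by
    intro k
    induction k with
    | zero => exact ⟨subset_rfl, hM⟩
    | succ k ih =>
      exact ⟨(hgsub k _ ih.1 ih.2).trans ih.1, hginf k _ ih.1 ih.2⟩
  have hanti : Antitone S := antitone_nat_of_succ_le fun k => hgsub k _ (hS k).1 (hS k).2
  obtain ⟨φ, hφ, hφS⟩ := extraction_forall_of_frequently (P := fun n k => k ∈ S n)
    (fun n => Nat.frequently_atTop_iff_infinite.2 (hS n).2)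
  refine ⟨Set.range φ, ?_, Set.infinite_range_of_injective hφ.injective, fun i => ?_⟩
  · rintro _ ⟨n, rfl⟩
    exact (hS n).1 (hφS n)
  -- Property `i` was secured at `S (i + 1)`, which contains `φ n` for all `n ≥ i + 1`.
  · refine hP i (S (i + 1)) _ (hgP i _ (hS i).1 (hS i).2) ?_
    refine ((Set.finite_Iio (i + 1)).image φ).subset ?_
    rintro _ ⟨⟨n, rfl⟩, hn⟩
    refine ⟨n, ?_, rfl⟩
    by_contra hlt
    exact hn (hanti (not_lt.1 hlt) (hφS n))

theorem exists_infinite_fiber_of_finite {α : Type*} [Finite α] (hM : M.Infinite) (c : ℕ → α) :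
    ∃ a, {n ∈ M | c n = a}.Infinite := by
  by_contra! h
  refine hM ((Set.finite_iUnion h).subset fun n hn => ?_)
  exact Set.mem_iUnion.2 ⟨c n, hn, rfl⟩

/-- If the pairs nowhere converge on each of finitely many sets, then some pair splits each of
these sets into two parts on which a subsequence of the pairs nowhere converges. -/
theorem PairsNowhereConverge.exists_split {ι : Type*} [Finite ι] {C : ι → Set Ω}
    (hM : M.Infinite) (h : ∀ i, PairsNowhereConverge L M (C i)) :
    ∃ j ∈ M, ∃ M' ⊆ M, M'.Infinite ∧
      ∀ i b, PairsNowhereConverge L M' (C i ∩ L b j) := by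
  by_contra! hcon
  obtain ⟨N, hNM, hN, hNP⟩ := exists_infinite_subset_forall
    (P := fun j N => j ∈ M → ∃ p : ι × Bool, PairsConvergeOn L N (C p.1 ∩ L p.2 j))
    (fun j N N' hjN hfin hj => (hjN hj).imp fun p hp => hp.of_diff_finite hfin) hM (by
      intro j N hN hNinf
      by_cases hj : j ∈ M
      · obtain ⟨i, b, hib⟩ := hcon j hj N hN hNinf
        simp only [PairsNowhereConverge, not_forall, not_not] at hib
        obtain ⟨N', hN', hinf, hconv⟩ := hib
        exact ⟨N', hN', hinf, fun _ => ⟨(i, b), hconv⟩⟩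
      · exact ⟨N, subset_rfl, hNinf, fun h => (hj h).elim⟩)
  have hNP' : ∀ j, ∃ p : ι × Bool, j ∈ N → PairsConvergeOn L N (C p.1 ∩ L p.2 j) := by
    intro j
    by_cases hj : j ∈ N
    · obtain ⟨p, hp⟩ := hNP j (hNM hj)
      exact ⟨p, fun _ => hp⟩
    · obtain ⟨j', hj'⟩ := hN.nonempty
      exact ⟨(hNP j' (hNM hj')).choose, fun h => (hj h).elim⟩
  choose c hc using hNP'
  -- Pigeonhole fixes one `(i, b)`. On the resulting subsequence each `t ∈ C i` either lies in some
  -- `L b j`, where convergence is known, or lies in no `L b n` at all.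
  obtain ⟨⟨i, b⟩, hinf⟩ := exists_infinite_fiber_of_finite hN c
  refine h i _ ((Set.sep_subset _ _).trans hNM) hinf fun t ht => ?_
  by_cases hex : ∃ j ∈ N, c j = (i, b) ∧ t ∈ L b j
  · obtain ⟨j, hj, hcj, htj⟩ := hex
    have := hc j hj
    rw [hcj] at this
    obtain ⟨b', hb'⟩ := this t ⟨ht, htj⟩
    exact ⟨b', hb'.subset fun n hn => ⟨hn.1.1, hn.2⟩⟩
  · refine ⟨b, Set.finite_empty.subset ?_⟩
    rintro n ⟨⟨hn, hcn⟩, hnt⟩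
    exact hex ⟨n, hn, hcn, hnt⟩

/-- **Rosenthal's combinatorial lemma**: a sequence of pairs of sets without convergent
subsequence has an independent subsequence. -/
theorem PairsNowhereConverge.exists_independent
    (hM : M.Infinite) (h : PairsNowhereConverge L M Set.univ) :
    ∃ φ : ℕ → ℕ, ∀ N (ε : ℕ → Bool), ∃ t, ∀ k < N, t ∈ L (ε k) (φ k) := by
  classical
  -- The finite family holds the cells cut out so far, one for each sign pattern; nowhere
  -- convergence keeps them nonempty.
  let State := {p : Set ℕ × Finset (Set Ω) //
    p.1.Infinite ∧ ∀ C ∈ p.2, PairsNowhereConverge L p.1 C}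
  have step : ∀ s : State, ∃ (j : ℕ) (s' : State),
      ∀ C ∈ s.1.2, ∀ b, C ∩ L b j ∈ s'.1.2 := by
    rintro ⟨⟨N, F⟩, hN, hF⟩
    obtain ⟨j, -, N', -, hN', hsplit⟩ := PairsNowhereConverge.exists_split
      (C := fun C : F => (C : Set Ω)) hN (fun C => hF C C.2)
    refine ⟨j, ⟨⟨N', (F ×ˢ Finset.univ).image fun p => p.1 ∩ L p.2 j⟩, hN', ?_⟩, ?_⟩
    · intro D hD
      obtain ⟨⟨C, b⟩, hCb, rfl⟩ := Finset.mem_image.1 hD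
      exact hsplit ⟨C, (Finset.mem_product.1 hCb).1⟩ b
    · intro C hC b
      exact Finset.mem_image.2 ⟨(C, b), Finset.mem_product.2 ⟨hC, Finset.mem_univ b⟩, rfl⟩
  choose j s' hs' using step
  let s : ℕ → State := fun k =>
    Nat.rec ⟨⟨M, {Set.univ}⟩, hM, by simpa using h⟩ (fun _ s => s' s) k
  refine ⟨fun k => j (s k), fun N ε => ?_⟩
  have key : {t | ∀ k < N, t ∈ L (ε k) (j (s k))} ∈ (s N).1.2 := by
    induction N with
    | zero => simp [s]
    | succ N ih =>
      have := hs' (s N) _ ih (ε N)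
      convert this using 1
      ext t
      simp only [Set.mem_ofPred_eq, Set.mem_inter_iff, Nat.lt_succ_iff_lt_or_eq]
      constructor
      · exact fun H => ⟨fun k hk => H k (Or.inl hk), H N (Or.inr rfl)⟩
      · rintro ⟨H, H'⟩ k (hk | rfl)
        exacts [H k hk, H']
  exact ((s N).2.2 _ key).nonempty (s N).2.1

end Combinatorics

/-! ### Rosenthal's dichotomy for real functions -/

/-- A pointwise bounded sequence of real functions has a pointwise convergent subsequence or
a subsequence oscillating independently across some gap `a < b`. -/
theorem exists_pointwise_convergent_or_independent {Ω : Type*} (u : ℕ → Ω → ℝ)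
    (hu : ∀ t, ∃ C, ∀ n, |u n t| ≤ C) :
    (∃ φ : ℕ → ℕ, StrictMono φ ∧ ∀ t, ∃ c, Tendsto (fun k => u (φ k) t) atTop (𝓝 c)) ∨
      ∃ a b : ℝ, a < b ∧ ∃ φ : ℕ → ℕ, ∀ N (ε : ℕ → Bool), ∃ t, ∀ k < N,
        (ε k = true → b < u (φ k) t) ∧ (ε k = false → u (φ k) t < a) := by
  let L : ℝ → ℝ → Bool → ℕ → Set Ω := fun a b i n =>
    {t | (i = true → b < u n t) ∧ (i = false → u n t < a)}
  by_cases h : ∃ a b : ℝ, a < b ∧ ∃ M : Set ℕ, M.Infinite ∧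
      PairsNowhereConverge (L a b) M Set.univ
  · obtain ⟨a, b, hab, M, hM, hL⟩ := h
    exact Or.inr ⟨a, b, hab, hL.exists_independent hM⟩
  · left
    push Not at h
    obtain ⟨e, he⟩ := exists_surjective_nat (ℚ × ℚ)
    obtain ⟨N, -, hN, hNP⟩ := exists_infinite_subset_forall (M := Set.univ)
      (P := fun i N => (e i).1 < (e i).2 →
        PairsConvergeOn (L (e i).1 (e i).2) N Set.univ)
      (fun i N N' hi hfin hlt => (hi hlt).of_diff_finite hfin) Set.infinite_univ (by
        intro i N _ hN
        by_cases hlt : (e i).1 < (e i).2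
        · have := h (e i).1 (e i).2 (by exact_mod_cast hlt) N hN
          simp only [PairsNowhereConverge, not_forall, not_not] at this
          obtain ⟨N', hN', hinf, hconv⟩ := this
          exact ⟨N', hN', hinf, fun _ => hconv⟩
        · exact ⟨N, subset_rfl, hN, fun h => (hlt h).elim⟩)
    obtain ⟨φ, hφ, hφN⟩ := extraction_of_frequently_atTop
      (P := fun n => n ∈ N) (Nat.frequently_atTop_iff_infinite.2 hN)
    refine ⟨φ, hφ, fun t => ?_⟩
    obtain ⟨C, hC⟩ := hu t
    refine tendsto_of_no_upcrossings Rat.denseRange_cast ?_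
      (isBoundedUnder_of ⟨C, fun k => (abs_le.1 (hC (φ k))).2⟩)
      (isBoundedUnder_of ⟨-C, fun k => (abs_le.1 (hC (φ k))).1⟩)
    rintro _ ⟨a, rfl⟩ _ ⟨b, rfl⟩ hab ⟨hlow, hhigh⟩
    obtain ⟨i, hi⟩ := he (a, b)
    have := hNP i
    rw [hi] at this
    obtain ⟨j, hj⟩ := this (by exact_mod_cast hab) t trivial
    rw [Nat.frequently_atTop_iff_infinite] at hlow hhigh
    cases j with
    | false =>
      refine hlow.image hφ.injective.injOn (hj.subset ?_)
      rintro _ ⟨k, hk, rfl⟩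
      exact ⟨hφN k, by simp, fun _ => hk⟩
    | true =>
      refine hhigh.image hφ.injective.injOn (hj.subset ?_)
      rintro _ ⟨k, hk, rfl⟩
      exact ⟨hφN k, fun _ => hk, by simp⟩

/-! ### Rademacher averages on the discrete cube -/

section Rademacher

open Finset

variable {𝕜 : Type*} [RCLike 𝕜]

/-- Orthogonality of the Rademacher functions. -/
theorem sum_powerset_norm_sq_sum_sign (s : Finset ℕ) (c : ℕ → 𝕜) :
    ∑ S ∈ s.powerset, ‖∑ n ∈ s, (if n ∈ S then c n else -c n)‖ ^ 2 =
      2 ^ #s * ∑ n ∈ s, ‖c n‖ ^ 2 := by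
  induction s using Finset.induction_on with
  | empty => simp
  | insert a s ha ih =>
    rw [sum_powerset_insert ha, ← sum_add_distrib, card_insert_of_notMem ha, sum_insert ha]
    have key : ∀ S ∈ s.powerset,
        ‖∑ n ∈ insert a s, (if n ∈ S then c n else -c n)‖ ^ 2 +
          ‖∑ n ∈ insert a s, (if n ∈ insert a S then c n else -c n)‖ ^ 2 =
        2 * ‖∑ n ∈ s, (if n ∈ S then c n else -c n)‖ ^ 2 + 2 * ‖c a‖ ^ 2 := by
      intro S hS
      have haS : a ∉ S := fun h => ha (mem_powerset.1 hS h)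
      have h1 : ∑ n ∈ s, (if n ∈ insert a S then c n else -c n) =
          ∑ n ∈ s, (if n ∈ S then c n else -c n) := by
        refine sum_congr rfl fun n hn => ?_
        have : n ≠ a := fun h => ha (h ▸ hn)
        simp [this]
      rw [sum_insert ha, sum_insert ha, h1, if_neg haS, if_pos (mem_insert_self a S)]
      have := parallelogram_law_with_norm 𝕜
        (∑ n ∈ s, (if n ∈ S then c n else -c n)) (c a)
      rw [add_comm (c a), neg_add_eq_sub]
      linarith
    rw [sum_congr rfl key, sum_add_distrib, ← mul_sum, ih, sum_const, card_powerset]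
    simp only [nsmul_eq_mul]
    push_cast
    ring

variable {E : Type*} [NormedAddCommGroup E] [NormedSpace 𝕜 E]

variable (𝕜) in
/-- The `k`-th Rademacher coefficient of a function on the cube of subsets of `s`. -/
noncomputable def rademacherCoeff (s : Finset ℕ) (f : Finset ℕ → E) (k : ℕ) : E :=
  ((2 : 𝕜) ^ #s)⁻¹ • ∑ S ∈ s.powerset, (if k ∈ S then f S else -f S)

theorem norm_inv_two_pow (n : ℕ) : ‖((2 : 𝕜) ^ n)⁻¹‖ = ((2 : ℝ) ^ n)⁻¹ := by
  simp

theorem norm_rademacherCoeff_le (s : Finset ℕ) {f : Finset ℕ → E} (hf : ∀ S, ‖f S‖ ≤ 1)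
    (k : ℕ) : ‖rademacherCoeff 𝕜 s f k‖ ≤ 1 := by
  rw [rademacherCoeff, norm_smul, norm_inv_two_pow, inv_mul_le_iff₀ (by positivity), mul_one]
  calc _ ≤ ∑ S ∈ s.powerset, (1 : ℝ) := norm_sum_le_of_le _ fun S _ => by
        split_ifs
        exacts [hf S, (norm_neg (f S)).trans_le (hf S)]
    _ = 2 ^ #s := by simp

/-- Exchanging sums leaves the `L¹` norm of a Rademacher sum, which Cauchy-Schwarz and orthogonality
bound by its `ℓ²` norm. -/
theorem norm_sum_smul_rademacherCoeff_sq_le (s : Finset ℕ) {f : Finset ℕ → E}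
    (hf : ∀ S, ‖f S‖ ≤ 1) (c : ℕ → 𝕜) :
    ‖∑ k ∈ s, c k • rademacherCoeff 𝕜 s f k‖ ^ 2 ≤ ∑ k ∈ s, ‖c k‖ ^ 2 := by
  have h1 : ∑ k ∈ s, c k • rademacherCoeff 𝕜 s f k =
      ((2 : 𝕜) ^ #s)⁻¹ • ∑ S ∈ s.powerset, (∑ k ∈ s, (if k ∈ S then c k else -c k)) • f S := by
    simp only [rademacherCoeff, smul_comm (c _), smul_sum (r := c _), sum_smul]
    rw [← smul_sum, sum_comm]
    refine congrArg _ (sum_congr rfl fun S _ => sum_congr rfl fun k _ => ?_)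
    split_ifs <;> simp
  have h2 : ‖∑ S ∈ s.powerset, (∑ k ∈ s, (if k ∈ S then c k else -c k)) • f S‖ ≤
      ∑ S ∈ s.powerset, ‖∑ k ∈ s, (if k ∈ S then c k else -c k)‖ :=
    norm_sum_le_of_le _ fun S _ => by
      rw [norm_smul]
      exact mul_le_of_le_one_right (norm_nonneg _) (hf S)
  have h3 := sq_sum_le_card_mul_sum_sq (s := s.powerset)
    (f := fun S => ‖∑ k ∈ s, (if k ∈ S then c k else -c k)‖)
  rw [sum_powerset_norm_sq_sum_sign, card_powerset] at h3
  push_cast at h3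
  rw [h1, norm_smul, norm_inv_two_pow, mul_pow, inv_pow, inv_mul_le_iff₀ (by positivity)]
  calc _ ≤ _ := pow_le_pow_left₀ (norm_nonneg _) h2 2
    _ ≤ _ := h3
    _ = _ := by ring

theorem le_re_rademacherCoeff_apply {s : Finset ℕ} {f : Finset ℕ → StrongDual 𝕜 E} {k : ℕ}
    (hk : k ∈ s) {x : E} {a b : ℝ}
    (ha : ∀ S ⊆ s, k ∉ S → RCLike.re (f S x) ≤ a) (hb : ∀ S ⊆ s, k ∈ S → b ≤ RCLike.re (f S x)) :
    (b - a) / 2 ≤ RCLike.re (rademacherCoeff 𝕜 s f k x) := by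
  have h1 : RCLike.re (rademacherCoeff 𝕜 s f k x) =
      ((2 : ℝ) ^ #s)⁻¹ * ∑ S ∈ s.powerset,
        (if k ∈ S then RCLike.re (f S x) else -RCLike.re (f S x)) := by
    have : ((2 : 𝕜) ^ #s)⁻¹ = ((((2 : ℝ) ^ #s)⁻¹ : ℝ) : 𝕜) := by push_cast; rfl
    rw [rademacherCoeff, this, smul_apply, smul_eq_mul, RCLike.re_ofReal_mul,
      _root_.sum_apply, map_sum]
    refine congrArg _ (sum_congr rfl fun S _ => ?_)
    split_ifs <;> simp
  have hks : k ∉ s.erase k := notMem_erase k s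
  have hcard : #s = #(s.erase k) + 1 := (card_erase_add_one hk).symm
  -- Pair `S` with `insert k S`: each of the `2 ^ (#s - 1)` pairs contributes at least `b - a`,
  -- whence the factor `1 / 2`.
  have h2 : (2 : ℝ) ^ #(s.erase k) * (b - a) ≤ ∑ S ∈ s.powerset,
      (if k ∈ S then RCLike.re (f S x) else -RCLike.re (f S x)) := by
    conv_rhs => rw [← insert_erase hk]
    rw [sum_powerset_insert hks, ← sum_add_distrib]
    calc _ = ∑ S ∈ (s.erase k).powerset, (b - a) := by simp [mul_sub]
      _ ≤ _ := sum_le_sum fun S hS => by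
        rw [mem_powerset] at hS
        have hSk : k ∉ S := fun h => hks (hS h)
        have hSs : S ⊆ s := hS.trans (erase_subset k s)
        rw [if_neg hSk, if_pos (mem_insert_self k S)]
        linarith [ha S hSs hSk, hb _ (insert_subset hk hSs) (mem_insert_self k S)]
  rw [h1, hcard, le_inv_mul_iff₀ (by positivity), pow_succ]
  linarith

end Rademacher

/-! ### Weakly null sequences and Dunford-Pettis sets -/

section Duality

variable {𝕜 E : Type*} [RCLike 𝕜] [NormedAddCommGroup E] [NormedSpace 𝕜 E]

theorem isWeaklyNull_iff {x : ℕ → E} :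
    IsWeaklyNull 𝕜 x ↔ ∀ f : StrongDual 𝕜 E, Tendsto (fun n => f (x n)) atTop (𝓝 0) := by
  have hinj : Function.Injective (topDualPairing 𝕜 E).flip := by
    intro y z hyz
    refine (SeparatingDual.eq_iff_forall_dual_eq (R := 𝕜)).2 fun f => ?_
    exact LinearMap.congr_fun hyz f
  have := WeakBilin.tendsto_iff_forall_eval_tendsto (topDualPairing 𝕜 E).flip
    (l := atTop) (f := fun n => toWeakSpace 𝕜 E (x n)) (x := (0 : WeakSpace 𝕜 E)) hinj
  refine this.trans (forall_congr' fun f => ?_)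
  have h0 : (topDualPairing 𝕜 E).flip (0 : WeakSpace 𝕜 E) f = 0 := map_zero f
  rw [h0]
  rfl

/-- A sequence satisfying an upper `ℓ²` estimate is weakly null. -/
theorem isWeaklyNull_of_norm_sum_smul_sq_le {g : ℕ → E}
    (hg : ∀ (m : ℕ) (c : ℕ → 𝕜),
      ‖∑ k ∈ Finset.range m, c k • g k‖ ^ 2 ≤ ∑ k ∈ Finset.range m, ‖c k‖ ^ 2) :
    IsWeaklyNull 𝕜 g := by
  rw [isWeaklyNull_iff]
  intro F
  have hbound : ∀ m, ∑ k ∈ Finset.range m, ‖F (g k)‖ ^ 2 ≤ ‖F‖ ^ 2 := by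
    intro m
    set s := ∑ k ∈ Finset.range m, ‖F (g k)‖ ^ 2 with hs
    have hs0 : 0 ≤ s := Finset.sum_nonneg fun k _ => by positivity
    -- Testing with conjugate coefficients gives `s ^ 2 ≤ ‖F‖ ^ 2 * s`.
    have h1 := hg m fun k => starRingEnd 𝕜 (F (g k))
    simp only [RCLike.norm_conj] at h1
    have h2 : F (∑ k ∈ Finset.range m, starRingEnd 𝕜 (F (g k)) • g k) = (s : 𝕜) := by
      rw [map_sum, hs]
      push_cast
      refine Finset.sum_congr rfl fun k _ => ?_
      rw [map_smul, smul_eq_mul, RCLike.conj_mul]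
    have h3 := F.le_opNorm (∑ k ∈ Finset.range m, starRingEnd 𝕜 (F (g k)) • g k)
    rw [h2, RCLike.norm_ofReal, abs_of_nonneg hs0] at h3
    have h4 : s ^ 2 ≤ ‖F‖ ^ 2 * s := by
      calc s ^ 2 ≤ _ := pow_le_pow_left₀ hs0 h3 2
        _ = ‖F‖ ^ 2 * _ := mul_pow _ _ 2
        _ ≤ ‖F‖ ^ 2 * s := by gcongr
    rcases hs0.eq_or_lt with h | h
    · rw [← h]; positivity
    · rw [sq s] at h4
      exact le_of_mul_le_mul_right h4 h
  have hsum := summable_of_sum_range_le (fun k => sq_nonneg ‖F (g k)‖) hbound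
  have hlim := hsum.tendsto_atTop_zero.sqrt
  simp only [Real.sqrt_sq (norm_nonneg _), Real.sqrt_zero] at hlim
  exact tendsto_zero_iff_norm_tendsto_zero.2 hlim

theorem exists_isWeaklyNull_of_independent {x : ℕ → E} {a b : ℝ}
    (h : ∀ N (ε : ℕ → Bool), ∃ f : StrongDual 𝕜 E, ‖f‖ ≤ 1 ∧ ∀ k < N,
      (ε k = true → b < RCLike.re (f (x k))) ∧ (ε k = false → RCLike.re (f (x k)) < a)) :
    ∃ g : ℕ → StrongDual 𝕜 E, IsWeaklyNull 𝕜 g ∧ ∀ k, (b - a) / 2 ≤ RCLike.re (g k (x k)) := by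
  choose f hf hfx using fun N (S : Finset ℕ) => h N fun k => decide (k ∈ S)
  let G : ℕ → ℕ → StrongDual 𝕜 E := fun N k => rademacherCoeff 𝕜 (Finset.range N) (f N) k
  -- By Banach-Alaoglu, one ultrafilter gives weak-star limits for all `k` at once, with no
  -- separability.
  have hlim : ∀ k, ∃ g : StrongDual 𝕜 E, ∀ y,
      Tendsto (fun N => G N k y) (hyperfilter ℕ) (𝓝 (g y)) := by
    intro k
    have hcomp := WeakDual.isCompact_closedBall (𝕜 := 𝕜) (0 : StrongDual 𝕜 E) 1
    have hmem : ∀ N, StrongDual.toWeakDual (G N k) ∈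
        (WeakDual.toStrongDual ⁻¹' Metric.closedBall (0 : StrongDual 𝕜 E) 1) := fun N =>
      mem_closedBall_zero_iff.2 (norm_rademacherCoeff_le (𝕜 := 𝕜) _ (hf N) k)
    obtain ⟨g, -, hg⟩ := hcomp.ultrafilter_le_nhds'
      ((hyperfilter ℕ).map fun N => StrongDual.toWeakDual (G N k))
      (Ultrafilter.mem_map.2 (Filter.univ_mem' hmem))
    exact ⟨WeakDual.toStrongDual g, fun y =>
      ((WeakDual.eval_continuous y).tendsto g).comp hg⟩
  choose g hg using hlim
  have hlarge : ∀ m, ∀ᶠ N in (hyperfilter ℕ : Filter ℕ), m ≤ N := fun m =>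
    (Nat.hyperfilter_le_atTop) (eventually_ge_atTop m)
  refine ⟨g, isWeaklyNull_of_norm_sum_smul_sq_le fun m c => ?_, fun k => ?_⟩
  · have hle : ‖∑ k ∈ Finset.range m, c k • g k‖ ≤
        Real.sqrt (∑ k ∈ Finset.range m, ‖c k‖ ^ 2) := by
      refine ContinuousLinearMap.opNorm_le_bound _ (Real.sqrt_nonneg _) fun y => ?_
      have ht : Tendsto (fun N => ‖(∑ k ∈ Finset.range m, c k • G N k) y‖) (hyperfilter ℕ)
          (𝓝 ‖(∑ k ∈ Finset.range m, c k • g k) y‖) := by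
        simp only [_root_.sum_apply, smul_apply]
        exact (tendsto_finsetSum _ fun k _ => (hg k y).const_smul (c k)).norm
      refine le_of_tendsto ht ((hlarge m).mono fun N hN => ?_)
      have h1 := norm_sum_smul_rademacherCoeff_sq_le (Finset.range N) (hf N)
        (fun k => if k ∈ Finset.range m then c k else 0)
      have hsub : Finset.range m ⊆ Finset.range N := Finset.range_subset_range.2 hN
      have h2 : ∑ k ∈ Finset.range N, (if k ∈ Finset.range m then c k else 0) • G N k =
          ∑ k ∈ Finset.range m, c k • G N k := by
        rw [← Finset.sum_subset hsub fun k _ hk => by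
          rw [if_neg hk]; exact zero_smul 𝕜 (G N k)]
        exact Finset.sum_congr rfl fun k hk => by rw [if_pos hk]
      have h3 : ∑ k ∈ Finset.range N, ‖if k ∈ Finset.range m then c k else 0‖ ^ 2 =
          ∑ k ∈ Finset.range m, ‖c k‖ ^ 2 := by
        have : ∀ k, ‖if k ∈ Finset.range m then c k else 0‖ ^ 2 =
            if k ∈ Finset.range m then ‖c k‖ ^ 2 else 0 := fun k => by split_ifs <;> simp
        simp only [this]
        rw [Finset.sum_ite_mem, Finset.inter_eq_right.2 hsub]
      rw [h2, h3] at h1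
      exact (ContinuousLinearMap.le_opNorm _ y).trans
        (mul_le_mul_of_nonneg_right (Real.le_sqrt_of_sq_le h1) (norm_nonneg y))
    calc _ ≤ _ := pow_le_pow_left₀ (norm_nonneg _) hle 2
      _ = _ := Real.sq_sqrt (Finset.sum_nonneg fun k _ => by positivity)
  · have ht : Tendsto (fun N => RCLike.re (G N k (x k))) (hyperfilter ℕ)
        (𝓝 (RCLike.re (g k (x k)))) :=
      (RCLike.continuous_re.tendsto _).comp (hg k (x k))
    refine ge_of_tendsto ht ((hlarge (k + 1)).mono fun N hN => ?_)
    exact le_re_rademacherCoeff_apply (Finset.mem_range.2 hN)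
      (fun S _ hS => ((hfx N S k hN).2 (by simpa using hS)).le)
      (fun S _ hS => ((hfx N S k hN).1 (by simpa using hS)).le)

/-- Dunford-Pettis sets are weakly precompact. -/
theorem IsDunfordPettisSet.exists_weakly_cauchy_subsequence {A : Set E}
    (hA : IsDunfordPettisSet 𝕜 A) {x : ℕ → E} (hx : ∀ n, x n ∈ A) :
    ∃ φ : ℕ → ℕ, StrictMono φ ∧ ∀ f : StrongDual 𝕜 E, ∃ c : ℝ,
      Tendsto (fun n => RCLike.re (f (x (φ n)))) atTop (𝓝 c) := by
  obtain ⟨R, hR⟩ := hA.1.exists_norm_le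
  rcases exists_pointwise_convergent_or_independent
    (fun n (f : Metric.closedBall (0 : StrongDual 𝕜 E) 1) => RCLike.re (f.1 (x n)))
    (fun f => ⟨‖f.1‖ * R, fun n => (RCLike.abs_re_le_norm _).trans
      ((f.1.le_opNorm _).trans (mul_le_mul_of_nonneg_left (hR _ (hx n)) (norm_nonneg _)))⟩) with
    ⟨φ, hφ, hconv⟩ | ⟨a, b, hab, φ, hind⟩
  · refine ⟨φ, hφ, fun f => ?_⟩
    rcases eq_or_ne f 0 with rfl | hf
    · exact ⟨0, by simp⟩
    have hnf : ‖f‖ ≠ 0 := norm_ne_zero_iff.2 hf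
    obtain ⟨c, hc⟩ := hconv ⟨((‖f‖⁻¹ : ℝ) : 𝕜) • f, by
      rw [mem_closedBall_zero_iff, norm_smul, RCLike.norm_ofReal, abs_of_nonneg (by positivity),
        inv_mul_cancel₀ hnf]⟩
    refine ⟨‖f‖ * c, (hc.const_mul ‖f‖).congr fun n => ?_⟩
    rw [smul_apply, smul_eq_mul, RCLike.re_ofReal_mul, mul_inv_cancel_left₀ hnf]
  · exfalso
    obtain ⟨g, hg, hgx⟩ := exists_isWeaklyNull_of_independent (x := x ∘ φ) (a := a) (b := b)
      (fun N ε => by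
        obtain ⟨f, hf⟩ := hind N ε
        exact ⟨f.1, mem_closedBall_zero_iff.1 f.2, hf⟩)
    have := Metric.tendstoUniformlyOn_iff.1 (hA.2 g hg) ((b - a) / 2) (by linarith)
    obtain ⟨k, hk⟩ := this.exists
    have h1 := hk (x (φ k)) (hx _)
    rw [dist_zero_left] at h1
    have h2 := hgx k
    have h3 := RCLike.re_le_norm (g k (x (φ k)))
    simp only [Function.comp_apply] at h2
    linarith

theorem isWeaklyNull_of_re {x : ℕ → E}
    (h : ∀ f : StrongDual 𝕜 E, Tendsto (fun n => RCLike.re (f (x n))) atTop (𝓝 0)) :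
    IsWeaklyNull 𝕜 x := by
  rw [isWeaklyNull_iff]
  intro f
  -- The real part of `I • f` is minus the imaginary part of `f`.
  have hI : Tendsto (fun n => RCLike.im (f (x n))) atTop (𝓝 0) := by
    have := (h ((RCLike.I : 𝕜) • f)).neg
    simpa [RCLike.mul_re] using this
  have h1 := ((RCLike.continuous_ofReal (K := 𝕜)).tendsto 0).comp (h f)
  have h2 := ((RCLike.continuous_ofReal (K := 𝕜)).tendsto 0).comp hI
  have h3 := h1.add (h2.mul_const (RCLike.I : 𝕜))
  simpa [Function.comp_def, RCLike.re_add_im] using h3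

theorem IsDunfordPettisSet.range_sub {A : Set E} (hA : IsDunfordPettisSet 𝕜 A) {x y : ℕ → E}
    (hx : ∀ n, x n ∈ A) (hy : ∀ n, y n ∈ A) :
    IsDunfordPettisSet 𝕜 (Set.range fun n => x n - y n) := by
  constructor
  · refine (hA.1.sub hA.1).subset ?_
    rintro _ ⟨n, rfl⟩
    exact Set.sub_mem_sub (hx n) (hy n)
  · intro f hf
    rw [Metric.tendstoUniformlyOn_iff]
    intro ε hε
    filter_upwards [Metric.tendstoUniformlyOn_iff.1 (hA.2 f hf) (ε / 2) (half_pos hε)] with n hn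
    rintro _ ⟨k, rfl⟩
    have h1 := hn _ (hx k)
    have h2 := hn _ (hy k)
    rw [dist_zero_left] at h1 h2 ⊢
    rw [map_sub]
    linarith [norm_sub_le (f n (x k)) (f n (y k))]

theorem IsWeaklyNull.tendsto_of_mem_isCompact {x : ℕ → E} {K : Set E} (hx : IsWeaklyNull 𝕜 x)
    (hK : IsCompact K) (hxK : ∀ n, x n ∈ K) : Tendsto x atTop (𝓝 0) := by
  rw [isWeaklyNull_iff] at hx
  refine hK.tendsto_nhds_of_unique_mapClusterPt (Eventually.of_forall hxK) fun y _ hy => ?_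
  refine SeparatingDual.eq_zero_of_forall_dual_eq_zero (R := 𝕜) fun f => ?_
  have := hy.continuousAt_comp (f.continuous.continuousAt)
  exact eq_of_nhds_neBot (this.neBot.mono (inf_le_inf_left _ (hx f)))

theorem exists_separated_sequence_of_not_totallyBounded {α : Type*} [PseudoMetricSpace α]
    {s : Set α} (hs : ¬TotallyBounded s) :
    ∃ δ > 0, ∃ x : ℕ → α, (∀ n, x n ∈ s) ∧ ∀ m n, m < n → δ ≤ dist (x n) (x m) := by
  rw [Metric.totallyBounded_iff] at hs
  push Not at hs
  obtain ⟨δ, hδ, h⟩ := hs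
  obtain ⟨x, hxs, hx⟩ := exists_seq_of_forall_finset_exists (P := fun y => y ∈ s)
    (r := fun y z => δ ≤ dist z y) (fun t _ => by
      obtain ⟨z, hz, hzt⟩ := Set.not_subset.1 (h t t.finite_toSet)
      refine ⟨z, hz, fun y hy => ?_⟩
      by_contra! hlt
      exact hzt (Set.mem_iUnion₂.2 ⟨y, hy, hlt⟩))
  exact ⟨δ, hδ, x, hxs, fun m n hmn => hx m n hmn⟩

end Duality

/-! ### The characterization of the DPrcP -/

theorem mainTheorem4 {𝕜 : Type*} {X : Type*} [RCLike 𝕜] [NormedAddCommGroup X] [NormedSpace 𝕜 X]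
    [CompleteSpace X] :
    HasDPrcP 𝕜 X ↔
      ∀ A : Set (StrongDual 𝕜 X), Bornology.IsBounded A → IsLDunfordPettisSet A := by
  constructor
  · intro hX A hA
    refine ⟨hA, fun x hx hxDP => ?_⟩
    have hlim : Tendsto x atTop (𝓝 0) :=
      hx.tendsto_of_mem_isCompact (hX _ hxDP) fun n => subset_closure ⟨n, rfl⟩
    obtain ⟨R, hR0, hR⟩ := hA.exists_pos_norm_le
    rw [Metric.tendstoUniformlyOn_iff]
    intro ε hε
    have := (tendsto_zero_iff_norm_tendsto_zero.1 hlim).eventually_lt_const (div_pos hε hR0)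
    filter_upwards [this] with n hn f hf
    rw [dist_zero_left]
    calc ‖f (x n)‖ ≤ ‖f‖ * ‖x n‖ := f.le_opNorm _
      _ ≤ R * ‖x n‖ := by gcongr; exact hR f hf
      _ < ε := by rwa [lt_div_iff₀' hR0] at hn
  · intro h A hA
    refine TotallyBounded.isCompact_of_isClosed (TotallyBounded.closure ?_) isClosed_closure
    by_contra hnot
    obtain ⟨δ, hδ, x, hxA, hsep⟩ := exists_separated_sequence_of_not_totallyBounded hnot
    obtain ⟨φ, hφ, hconv⟩ := hA.exists_weakly_cauchy_subsequence hxA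
    have hnull : IsWeaklyNull 𝕜 fun n => x (φ (n + 1)) - x (φ n) :=
      isWeaklyNull_of_re fun f => by
        obtain ⟨c, hc⟩ := hconv f
        have := ((tendsto_add_atTop_iff_nat 1).2 hc).sub hc
        simpa using this
    have hunif := (h _ (Metric.isBounded_closedBall (x := 0) (r := 1))).2 _ hnull
      (hA.range_sub (fun n => hxA (φ (n + 1))) fun n => hxA (φ n))
    obtain ⟨n, hn⟩ := (Metric.tendstoUniformlyOn_iff.1 hunif (δ / 2) (half_pos hδ)).exists
    obtain ⟨f, hf, hfx⟩ := exists_dual_vector'' 𝕜 (x (φ (n + 1)) - x (φ n))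
    have h1 := hn f (mem_closedBall_zero_iff.2 hf)
    rw [dist_zero_left, hfx, RCLike.norm_ofReal, abs_of_nonneg (norm_nonneg _)] at h1
    have h2 := hsep _ _ (hφ n.lt_succ_self)
    rw [dist_eq_norm] at h2
    linarith
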